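/- \textbf{Setting.} Let $H$ be a complex Hilbert space and let ``operator'' mean bounded linear operator on $H$. A \emph{spectral decomposition} of an operator $X$ consists of a (not necessarily self-adjoint) strongly countably additive projection-valued measure $E$ on the Borel sets of $\mathbb{C}$ with $E(\mathbb C)=I$, $E(A\cap B)=E(A)E(B)$, $E(\sigma(X))=I$, commuting with $X$, and a Borel function $\lambda\mapsto m_\lambda\in\{1,2,\dots\}$, such that $$X=S+N,\qquad S=\int_{\sigma(X)}\lambda\,dE(\lambda),\qquad N=X-S=\int_{\sigma(X)}(X-\lambda I)\,dE(\lambda),$$ where $N$ is quasi-nilpotent and $N^{q}E(\{\lambda: m_\lambda\le q\})=0$ for all $q\ge 0$ (i.e. $((X-\lambda I)dE(\lambda))^q=0$ for $q\ge m_\lambda$). For operators $X_1,X_2$ with spectral decompositions $(E_1,m)$, $(E_2,m')$, an operator $Y$ and $\beta(z_1,z_2)$ analytic near $\sigma(X_1)\times\sigma(X_2)$, the \emph{generalized double operator integral} is $$T_\beta^{X_1,X_2}(Y)=\int_{\sigma(X_1)}\int_{\sigma(X_2)}\sum_{q_1=0}^{m_{\lambda_1}-1}\sum_{q_2=0}^{m'_{\lambda_2}-1}\frac{\beta^{(q_1,q_2)}(\lambda_1,\lambda_2)}{q_1!\,q_2!}(X_1-\lambda_1I)^{q_1}dE_1(\lambda_1)\,Y\,(X_2-\lambda_2I)^{q_2}dE_2(\lambda_2),$$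 the integral being the operator-norm limit, along refinement, of Riemann sums over finite tagged Borel partitions of $\sigma(X_1)$ and $\sigma(X_2)$. For analytic $f$ put $f^{[1]}(x,y)=\frac{f(x)-f(y)}{x-y}$ for $x\ne y$, $f^{[1]}(x,x)=f'(x)$, and let $f^{[2]}(x,y,z)=\frac{f^{[1]}(x,z)-f^{[1]}(y,z)}{x-y}$ for $x\neq y$, $f^{[2]}(x,x,z)=\partial_x f^{[1]}(x,z)$. \textbf{Theorem.} Let $X_{1,\ell}$, $X_{2,\ell}$ ($\ell\in\mathbb N$), $X_1$, $X_2$ be operators with spectral decompositions such that $X_{1,\ell}\to X_1$ and $X_{2,\ell}\to X_2$ in operator norm. Let $f$ be analytic in $\{|z|<R\}$ and let $K$, the union of the spectra of all the $X_{1,\ell}$, $X_1$, $X_{2,\ell}$, $X_2$, be contained in $\{|z|<R\}$. Assume that for every $(\vartheta_1,\vartheta_2,\vartheta_3)\in\mathbb N_0^3$ the partial derivative $\partial_{\lambda_1}^{\vartheta_1}\partial_{\lambda_2}^{\vartheta_2}\partial_{\lambda_3}^{\vartheta_3}f^{[2]}$ is bounded on $K^3$. Then for every operator $Y$ the integrals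 $T_{f^{[1]}}^{X_{1,\ell_1},X_{2,\ell_2}}(Y)$ (for all $\ell_1,\ell_2$) and $T_{f^{[1]}}^{X_1,X_2}(Y)$ exist, and $$\lim_{\ell_1,\ell_2\to\infty}\left\|T_{f^{[1]}}^{X_{1,\ell_1},X_{2,\ell_2}}(Y)-T_{f^{[1]}}^{X_1,X_2}(Y)\right\|=0 .$$ -/

import Mathlib

open Filter Topology

namespace GDOI

variable {H : Type*} [NormedAddCommGroup H] [InnerProductSpace ℂ H] [CompleteSpace H]

/-- A finite partition of `s` into nonempty Borel sets, with a tag chosen in every cell.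
(`tag` is only relevant on the cells.) -/
structure TaggedPartition (s : Set ℂ) where
  cells : Finpartition s
  measurableSet_of_mem : ∀ A ∈ cells.parts, MeasurableSet A
  tag : Set ℂ → ℂ
  tag_mem : ∀ A ∈ cells.parts, tag A ∈ A

/-- Tagged partitions of `s`, directed by refinement: a limit along this filter is a limit of
Riemann sums over finer and finer Borel partitions, uniformly in the tags. -/
def refinement (s : Set ℂ) : Filter (TaggedPartition s) :=
  ⨅ Q : TaggedPartition s, 𝓟 {P | P.cells ≤ Q.cells}

/-- Any finite Borel partition can be tagged. -/
theorem exists_tagged {s : Set ℂ} (p : Finpartition s)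
    (hp : ∀ A ∈ p.parts, MeasurableSet A) : ∃ P : TaggedPartition s, P.cells = p := by
  classical
  refine ⟨⟨p, hp, fun A => if h : A.Nonempty then h.some else 0, ?_⟩, rfl⟩
  intro A hA
  have hne : A.Nonempty := Set.nonempty_iff_ne_empty.2 (p.ne_bot hA)
  simp only [hne, dif_pos]
  exact hne.some_mem

/-- On a Borel set the refinement filter is proper, so limits along it are unique. -/
theorem refinement_neBot {s : Set ℂ} (hs : MeasurableSet s) : (refinement s).NeBot := by
  classical
  have hne : Nonempty (TaggedPartition s) := by
    rcases s.eq_empty_or_nonempty with h | h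
    · subst h
      obtain ⟨P, -⟩ := exists_tagged (Finpartition.empty (Set ℂ)) (by simp)
      exact ⟨P⟩
    · obtain ⟨P, -⟩ := exists_tagged (Finpartition.indiscrete (a := s) h.ne_empty)
        (by simpa using hs)
      exact ⟨P⟩
  refine iInf_neBot_of_directed ?_ fun Q => ?_
  · intro Q R
    obtain ⟨P, hP⟩ := exists_tagged (Q.cells ⊓ R.cells) (by
      intro A hA
      rw [Finpartition.parts_inf] at hA
      obtain ⟨-, hA⟩ := Finset.mem_erase.1 hA
      obtain ⟨⟨B, C⟩, hBC, rfl⟩ := Finset.mem_image.1 hA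
      obtain ⟨hB, hC⟩ := Finset.mem_product.1 hBC
      exact (Q.measurableSet_of_mem B hB).inter (R.measurableSet_of_mem C hC))
    refine ⟨P, ?_, ?_⟩
    · exact principal_mono.2 fun T hT => le_trans hT (hP.le.trans inf_le_left)
    · exact principal_mono.2 fun T hT => le_trans hT (hP.le.trans inf_le_right)
  · exact principal_neBot_iff.2 ⟨Q, le_refl Q.cells⟩

/-- A spectral measure on the Borel sets of `ℂ`: a strongly countably additive, multiplicative
family of (not necessarily orthogonal) bounded projections with `E(ℂ) = I`. -/
structure ProjectionMeasure (H : Type*) [NormedAddCommGroup H] [InnerProductSpace ℂ H] where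
  E : Set ℂ → (H →L[ℂ] H)
  E_univ : E Set.univ = 1
  E_inter : ∀ A B, MeasurableSet A → MeasurableSet B → E (A ∩ B) = E A * E B
  hasSum_E : ∀ A : ℕ → Set ℂ, (∀ n, MeasurableSet (A n)) → Pairwise (Function.onFun Disjoint A) →
    ∀ x : H, HasSum (fun n => E (A n) x) (E (⋃ n, A n) x)

/-- A spectral decomposition
`X = ∫_{σ(X)} λ dE(λ) + ∫_{σ(X)} (X - λ I) dE(λ) = S + N`
of a bounded, not necessarily normal, operator.  Since `∫ dE = I`, the second integral is
`N = X - S`, and `∫_B (X - λ I)^q dE(λ) = N ^ q E(B)`.  The function `m` gives the orders of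
nilpotency `m_λ`: `((X - λ I) dE(λ))^q = 0` for `q ≥ m_λ`. -/
structure SpectralDecomposition (X : H →L[ℂ] H) extends ProjectionMeasure H where
  /-- `E` lives on the spectrum of `X`. -/
  E_spectrum : E (spectrum ℂ X) = 1
  commute_E : ∀ B, MeasurableSet B → Commute X (E B)
  /-- the scalar part `S` -/
  S : H →L[ℂ] H
  /-- `S = ∫_{σ(X)} λ dE(λ)` -/
  tendsto_S : Tendsto (fun P : TaggedPartition (spectrum ℂ X) =>
    ∑ A ∈ P.cells.parts, P.tag A • E A) (refinement (spectrum ℂ X)) (𝓝 S)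
  /-- `N = X - S` is quasi-nilpotent (automatic if the orders `m` are bounded). -/
  quasinilpotent : spectralRadius ℂ (X - S) = 0
  m : ℂ → ℕ
  one_le_m : ∀ z, 1 ≤ m z
  measurable_m : Measurable m
  nilpotent : ∀ q : ℕ, (X - S) ^ q * E {z | m z ≤ q} = 0

/-- The mixed partial derivative `β^{(q₁,q₂)}(z₁, z₂)`. -/
noncomputable def partialDeriv₂ (β : ℂ → ℂ → ℂ) (q₁ q₂ : ℕ) (z₁ z₂ : ℂ) : ℂ :=
  iteratedDeriv q₁ (fun u => iteratedDeriv q₂ (fun v => β u v) z₂) z₁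

/-- The mixed partial derivative `γ^{(q₁,q₂,q₃)}(z₁, z₂, z₃)`. -/
noncomputable def partialDeriv₃ (γ : ℂ → ℂ → ℂ → ℂ) (q₁ q₂ q₃ : ℕ) (z₁ z₂ z₃ : ℂ) : ℂ :=
  iteratedDeriv q₁ (fun u => partialDeriv₂ (fun v w => γ u v w) q₂ q₃ z₂ z₃) z₁

/-- The Riemann sum, for tagged partitions `P` of `σ(X₁)` and `Q` of `σ(X₂)`, of
`∫∫ ∑_{q₁ < m_{λ₁}} ∑_{q₂ < m_{λ₂}} β^{(q₁,q₂)}(λ₁,λ₂) / (q₁! q₂!)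
  (X₁ - λ₁ I)^{q₁} dE₁(λ₁) Y (X₂ - λ₂ I)^{q₂} dE₂(λ₂)`.
The terms with `q₁ = q₂ = 0`, with `q₁ = 0 < q₂`, with `q₂ = 0 < q₁` and with `q₁, q₂ > 0` are
the four integrals that make up the generalized double operator integral. -/
noncomputable def riemannSum {X₁ X₂ : H →L[ℂ] H}
    (D₁ : SpectralDecomposition X₁) (D₂ : SpectralDecomposition X₂)
    (β : ℂ → ℂ → ℂ) (Y : H →L[ℂ] H)
    (P : TaggedPartition (spectrum ℂ X₁)) (Q : TaggedPartition (spectrum ℂ X₂)) : H →L[ℂ] H :=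
  ∑ A ∈ P.cells.parts, ∑ B ∈ Q.cells.parts,
    ∑ q₁ ∈ Finset.range (D₁.m (P.tag A)), ∑ q₂ ∈ Finset.range (D₂.m (Q.tag B)),
      (partialDeriv₂ β q₁ q₂ (P.tag A) (Q.tag B) / ((q₁.factorial : ℂ) * (q₂.factorial : ℂ))) •
        ((X₁ - P.tag A • (1 : H →L[ℂ] H)) ^ q₁ * D₁.E A * Y *
          ((X₂ - Q.tag B • (1 : H →L[ℂ] H)) ^ q₂ * D₂.E B))

/-- The generalized double operator integral `T_β^{X₁,X₂}(Y)` exists and equals `T`: the Riemann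
sums converge to `T` in operator norm. -/
def HasGDOI {X₁ X₂ : H →L[ℂ] H}
    (D₁ : SpectralDecomposition X₁) (D₂ : SpectralDecomposition X₂)
    (β : ℂ → ℂ → ℂ) (Y T : H →L[ℂ] H) : Prop :=
  Tendsto (fun p : TaggedPartition (spectrum ℂ X₁) × TaggedPartition (spectrum ℂ X₂) =>
      riemannSum D₁ D₂ β Y p.1 p.2)
    (refinement (spectrum ℂ X₁) ×ˢ refinement (spectrum ℂ X₂)) (𝓝 T)

/-- The generalized double operator integral `T_β^{X₁,X₂}(Y)` (meaningful when it exists in the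
sense of `HasGDOI`). -/
noncomputable def gdoi {X₁ X₂ : H →L[ℂ] H}
    (D₁ : SpectralDecomposition X₁) (D₂ : SpectralDecomposition X₂)
    (β : ℂ → ℂ → ℂ) (Y : H →L[ℂ] H) : H →L[ℂ] H :=
  limUnder (refinement (spectrum ℂ X₁) ×ˢ refinement (spectrum ℂ X₂))
    (fun p : TaggedPartition (spectrum ℂ X₁) × TaggedPartition (spectrum ℂ X₂) =>
      riemannSum D₁ D₂ β Y p.1 p.2)

/-- If the integral exists, `gdoi` is its value. -/
theorem HasGDOI.gdoi_eq {X₁ X₂ : H →L[ℂ] H}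
    {D₁ : SpectralDecomposition X₁} {D₂ : SpectralDecomposition X₂}
    {β : ℂ → ℂ → ℂ} {Y T : H →L[ℂ] H} (h : HasGDOI D₁ D₂ β Y T) : gdoi D₁ D₂ β Y = T := by
  have h₁ := refinement_neBot (spectrum.isClosed (𝕜 := ℂ) X₁).measurableSet
  have h₂ := refinement_neBot (spectrum.isClosed (𝕜 := ℂ) X₂).measurableSet
  exact Tendsto.limUnder_eq h

/-- The first divided difference `f^{[1]}`, with its confluent value on the diagonal. -/
noncomputable def dividedDiff₁ (f : ℂ → ℂ) (x y : ℂ) : ℂ :=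
  open Classical in
  if x = y then deriv f x else (f x - f y) / (x - y)

/-- The second divided difference `f^{[2]}`: the first divided difference of
`t ↦ f^{[1]}(t, z)` at `x, y`. -/
noncomputable def dividedDiff₂ (f : ℂ → ℂ) (x y z : ℂ) : ℂ :=
  dividedDiff₁ (fun t => dividedDiff₁ f t z) x y

end GDOI

/-!
On the disc `|z| < R` write `f(z) = ∑ aₙ zⁿ`. The geometric sum turns this into a double power
series `f^{[1]}(x, y) = ∑ a_{i+j+1} x^i y^j` (`exists_hasSum_dividedDiff₁`), and the generalized
double operator integral turns out to be the value of the series at the operators,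
`T(Y) = ∑ a_{i+j+1} X₁^i Y X₂^j` (`hasGDOI_doubleSeries`). By Gelfand's formula the powers of the
operators near `X₁` and `X₂` are bounded by `C r^i` with a common `r < R`, so the series depends
continuously on `X₁` and `X₂` by dominated convergence (`tendsto_doubleSeries`), which is the
asserted limit.

To identify the integral, the series, differentiated termwise (`hasSum_partialDeriv₂`), is inserted
into a Riemann sum. This separates the variables: the Riemann sum becomes
`∑ a_{i+j+1} R_P(i) Y R_Q(j)` (`hasSum_riemannSum`), where
`R_P(i) = ∑_A ∑_{q < m(t_A)} C(i,q) t_A^{i-q} (X - t_A)^q E(A)` is a Riemann sum of the single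
integral of `λ^i` (`powSum`). Dominated convergence along refinement needs two facts.

* `R_P(i) → X^i` (`tendsto_powSum`). Without the restriction `q < m(t_A)` the sum is exactly `X^i`,
  by the binomial theorem. The omitted terms are expanded with `X - t = (X - S) + (S - t)`. The part
  `(X - S)^q E(A)` is zero as soon as the partition resolves the level sets of `m` up to `q`; every
  other part contains a positive power of `S - t_A`, which is of the size of the mesh.
* `‖R_P(i)‖ ≤ C r^i` for all fine `P` and all `i`, with `r < R`
  (`exists_eventually_norm_powSum_le`). The same expansion is used, with `X - S` quasi-nilpotent and
  the mesh small; no bound on `m` is needed.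

Both rest on the estimate `‖∑ c_A (S - t_A)^k E(A)‖ ≤ M sup |c_A| mesh^k`
(`exists_norm_sum_sub_pow_le`). It holds because integrals of simple functions against `E` are
bounded by the supremum of the function (`ProjectionMeasure.exists_norm_sum_le`): each vector
measure `E(·) x` has finite semivariation, and the uniform boundedness principle makes the bound
uniform in `x`. This replaces the orthogonality of the projections, which is not assumed.
-/

namespace GDOI

/-! ### Boundedness of a spectral measure -/

section Bounded

variable {H : Type*} [NormedAddCommGroup H] [InnerProductSpace ℂ H]

theorem ProjectionMeasure.E_empty (D : ProjectionMeasure H) : D.E ∅ = 0 := by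
  ext x
  have h := (D.hasSum_E (fun _ => ∅) (fun _ => MeasurableSet.empty)
    (fun _ _ _ => by simp [Function.onFun]) x).summable
  simpa using (tendsto_nhds_unique h.tendsto_atTop_zero tendsto_const_nhds).symm

open Classical in
/-- The vector measure `B ↦ E(B) x`, with the value `0` on the sets that are not Borel. -/
noncomputable def ProjectionMeasure.vectorMeasure (D : ProjectionMeasure H) (x : H) :
    MeasureTheory.VectorMeasure ℂ H where
  measureOf' B := if MeasurableSet B then D.E B x else 0
  empty' := by simp [D.E_empty]
  not_measurable' B hB := by simp [hB]
  m_iUnion' A hA hd := by simpa [hA, MeasurableSet.iUnion hA] using D.hasSum_E A hA hd x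

theorem ProjectionMeasure.vectorMeasure_apply (D : ProjectionMeasure H) (x : H) {B : Set ℂ}
    (hB : MeasurableSet B) : D.vectorMeasure x B = D.E B x := by
  simp [vectorMeasure, hB]

/-- A vector measure has finite semivariation: sums over disjoint sets with real coefficients in
`[-1, 1]` are bounded, even where the variation is infinite. -/
theorem norm_sum_real_smul_le_bound {X V : Type*} [MeasurableSpace X] [NormedAddCommGroup V]
    [NormedSpace ℝ V] (μ : MeasureTheory.VectorMeasure X V) (P : Finset (Set X))
    (hd : (P : Set (Set X)).PairwiseDisjoint id) (c : Set X → ℝ) (hc : ∀ A ∈ P, |c A| ≤ 1) :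
    ‖∑ A ∈ P, c A • μ A‖ ≤ μ.bound := by
  obtain ⟨g, hg, hgv⟩ := exists_dual_vector'' ℝ (∑ A ∈ P, c A • μ A)
  have h1 : ∑ A ∈ P, ‖g (μ A)‖ₑ ≤ μ.bound := by
    refine le_trans ?_ (MeasureTheory.VectorMeasure.semivariation_apply_le_bound (s := Set.univ))
    have hg' : ‖g‖ₑ ≤ 1 := by
      rw [← ofReal_norm]
      simpa only [ENNReal.ofReal_le_one] using hg
    refine le_trans ?_ (le_biSup (fun ℓ : StrongDual ℝ V =>
      (μ.mapRange (ℓ : V →+ ℝ) ℓ.continuous).variation Set.univ) hg')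
    have := (μ.mapRange (g : V →+ ℝ) g.continuous).le_variation (s := Set.univ)
      MeasurableSet.univ (P := P) (fun _ _ => Set.subset_univ _) hd
    exact this
  have h2 : ∑ A ∈ P, ‖g (μ A)‖ ≤ μ.bound := by
    have : ∑ A ∈ P, ‖g (μ A)‖₊ ≤ μ.bound := by
      rw [← ENNReal.coe_le_coe]
      simpa [enorm_eq_nnnorm] using h1
    simpa only [NNReal.coe_sum, coe_nnnorm] using NNReal.coe_le_coe.2 this
  calc ‖∑ A ∈ P, c A • μ A‖ = ∑ A ∈ P, c A * g (μ A) := by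
        have : g (∑ A ∈ P, c A • μ A) = ‖∑ A ∈ P, c A • μ A‖ := by simpa using hgv
        rw [← this]; simp
    _ ≤ ∑ A ∈ P, ‖g (μ A)‖ := by
        refine Finset.sum_le_sum fun A hA => (le_abs_self _).trans ?_
        rw [abs_mul, Real.norm_eq_abs]
        exact mul_le_of_le_one_left (abs_nonneg _) (hc A hA)
    _ ≤ μ.bound := h2

/-- Integrals of simple functions against a spectral measure are bounded in operator norm by the
supremum of the function. -/
theorem ProjectionMeasure.exists_norm_sum_le [CompleteSpace H] (D : ProjectionMeasure H) :
    ∃ M : ℝ, 0 ≤ M ∧ ∀ (P : Finset (Set ℂ)), (∀ A ∈ P, MeasurableSet A) →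
      (P : Set (Set ℂ)).PairwiseDisjoint id → ∀ (c : Set ℂ → ℂ) (κ : ℝ), 0 ≤ κ →
      (∀ A ∈ P, ‖c A‖ ≤ κ) → ‖∑ A ∈ P, c A • D.E A‖ ≤ M * κ := by
  let ι := {p : Finset (Set ℂ) × (Set ℂ → ℂ) // (∀ A ∈ p.1, MeasurableSet A) ∧
    (p.1 : Set (Set ℂ)).PairwiseDisjoint id ∧ ∀ A ∈ p.1, ‖p.2 A‖ ≤ 1}
  obtain ⟨M, hM⟩ : ∃ M, ∀ p : ι, ‖∑ A ∈ p.1.1, p.1.2 A • D.E A‖ ≤ M := by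
    refine banach_steinhaus fun x => ⟨2 * (D.vectorMeasure x).bound, ?_⟩
    rintro ⟨⟨P, c⟩, hm, hd, hc⟩
    have hre := norm_sum_real_smul_le_bound (D.vectorMeasure x) P hd (fun A => (c A).re)
      fun A hA => (Complex.abs_re_le_norm _).trans (hc A hA)
    have him := norm_sum_real_smul_le_bound (D.vectorMeasure x) P hd (fun A => (c A).im)
      fun A hA => (Complex.abs_im_le_norm _).trans (hc A hA)
    have key : (∑ A ∈ P, c A • D.E A) x =
        ∑ A ∈ P, (c A).re • D.vectorMeasure x A +
          Complex.I • ∑ A ∈ P, (c A).im • D.vectorMeasure x A := by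
      rw [sum_apply, Finset.smul_sum, ← Finset.sum_add_distrib]
      refine Finset.sum_congr rfl fun A hA => ?_
      rw [D.vectorMeasure_apply x (hm A hA), smul_apply,
        ← Complex.coe_smul (c A).re, ← Complex.coe_smul (c A).im, smul_smul, ← add_smul,
        mul_comm, Complex.re_add_im]
    simp only
    rw [key]
    refine (norm_add_le _ _).trans ?_
    rw [norm_smul, Complex.norm_I]
    linarith
  have hM0 : 0 ≤ M := (norm_nonneg _).trans (hM ⟨(∅, 0), by simp⟩)
  refine ⟨M, hM0, fun P hm hd c κ hκ hc => ?_⟩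
  rcases hκ.eq_or_lt with rfl | hκ
  · rw [Finset.sum_eq_zero fun A hA => ?_]
    · simp
    · rw [norm_le_zero_iff.1 (hc A hA), zero_smul]
  · have := hM ⟨(P, fun A => (κ : ℂ)⁻¹ * c A), hm, hd, fun A hA => by
      simp only [norm_mul, norm_inv, Complex.norm_real, Real.norm_eq_abs, abs_of_pos hκ]
      rw [inv_mul_le_iff₀ hκ, mul_one]
      exact hc A hA⟩
    simp only [mul_smul, ← Finset.smul_sum] at this
    rw [norm_smul, norm_inv, Complex.norm_real, Real.norm_eq_abs, abs_of_pos hκ,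
      inv_mul_le_iff₀ hκ] at this
    linarith

end Bounded

/-! ### Geometric bounds for powers -/

section PowerBound

/-- Gelfand's formula, uniformly near `x`: the `k` with `‖x ^ k‖ < r ^ k` also serves the elements
near `x`, and the remaining powers are handled by division with remainder by `k`. -/
theorem exists_eventually_norm_pow_le {A : Type*} [NormedRing A] [NormedAlgebra ℂ A]
    [CompleteSpace A] (x : A) {r : ℝ} (hr : 0 < r)
    (hx : spectralRadius ℂ x < ENNReal.ofReal r) :
    ∃ C : ℝ, 0 ≤ C ∧ ∀ᶠ y in 𝓝 x, ∀ n : ℕ, ‖y ^ n‖ ≤ C * r ^ n := by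
  obtain ⟨k, hk, hk0⟩ : ∃ k : ℕ, ‖x ^ k‖ < r ^ k ∧ 0 < k := by
    have h := (spectrum.pow_norm_pow_one_div_tendsto_nhds_spectralRadius x).eventually_lt_const hx
    obtain ⟨k, hk, hk0⟩ := (h.and (eventually_gt_atTop 0)).exists
    refine ⟨k, ?_, hk0⟩
    rw [ENNReal.ofReal_lt_ofReal_iff hr] at hk
    have hk' : (k : ℝ) ≠ 0 := by positivity
    have := pow_lt_pow_left₀ hk (by positivity) hk0.ne'
    rwa [← Real.rpow_natCast (‖x ^ k‖ ^ (1 / (k : ℝ))), ← Real.rpow_mul (norm_nonneg _),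
      one_div_mul_cancel hk', Real.rpow_one] at this
  set B : ℝ := max (‖x‖ + 1) r with hB
  have hBr : 1 ≤ B / r := by rw [one_le_div hr]; exact le_max_right _ _
  refine ⟨(1 + ‖(1 : A)‖) * (1 + ‖(1 : A)‖) * (B / r) ^ k, by positivity, ?_⟩
  have e1 : ∀ᶠ y in 𝓝 x, ‖y ^ k‖ < r ^ k :=
    ((continuous_pow k).norm.tendsto x).eventually_lt_const hk
  have e2 : ∀ᶠ y in 𝓝 x, ‖y‖ < ‖x‖ + 1 :=
    (continuous_norm.tendsto x).eventually_lt_const (lt_add_one _)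
  -- `A` need not have a normalized unit, so the powers with exponent `0` contribute `‖1‖`.
  have aux : ∀ (z : A) (s : ℝ) (n : ℕ), 0 ≤ s → ‖z‖ ≤ s → ‖z ^ n‖ ≤ (1 + ‖(1 : A)‖) * s ^ n := by
    intro z s n hs hz
    rcases n.eq_zero_or_pos with rfl | hn
    · simp
    · calc ‖z ^ n‖ ≤ ‖z‖ ^ n := norm_pow_le' z hn
        _ ≤ s ^ n := by gcongr
        _ ≤ (1 + ‖(1 : A)‖) * s ^ n := by
          refine le_mul_of_one_le_left (by positivity) ?_
          simp
  filter_upwards [e1, e2] with y h1 h2 n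
  have hB0 : 0 ≤ B := hr.le.trans (le_max_right _ _)
  have hn : y ^ n = (y ^ k) ^ (n / k) * y ^ (n % k) := by
    rw [← pow_mul, ← pow_add, Nat.div_add_mod]
  have hr' : r ^ n = (r ^ k) ^ (n / k) * r ^ (n % k) := by
    rw [← pow_mul, ← pow_add, Nat.div_add_mod]
  have hBB : B ^ (n % k) ≤ (B / r) ^ k * r ^ (n % k) := by
    calc B ^ (n % k) = (B / r) ^ (n % k) * r ^ (n % k) := by
          rw [← mul_pow, div_mul_cancel₀ _ hr.ne']
      _ ≤ (B / r) ^ k * r ^ (n % k) := by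
          gcongr
          exact (Nat.mod_lt _ hk0).le
  calc ‖y ^ n‖ ≤ ‖(y ^ k) ^ (n / k)‖ * ‖y ^ (n % k)‖ := by rw [hn]; exact norm_mul_le _ _
    _ ≤ ((1 + ‖(1 : A)‖) * (r ^ k) ^ (n / k)) * ((1 + ‖(1 : A)‖) * B ^ (n % k)) := by
        gcongr
        · exact aux _ _ _ (by positivity) h1.le
        · exact aux _ _ _ hB0 (h2.le.trans (le_max_left _ _))
    _ ≤ ((1 + ‖(1 : A)‖) * (r ^ k) ^ (n / k)) *
          ((1 + ‖(1 : A)‖) * ((B / r) ^ k * r ^ (n % k))) := by gcongr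
    _ = _ := by rw [hr']; ring

theorem exists_norm_pow_le {A : Type*} [NormedRing A] [NormedAlgebra ℂ A]
    [CompleteSpace A] (x : A) {r : ℝ} (hr : 0 < r)
    (hx : spectralRadius ℂ x < ENNReal.ofReal r) :
    ∃ C : ℝ, 0 ≤ C ∧ ∀ n : ℕ, ‖x ^ n‖ ≤ C * r ^ n := by
  obtain ⟨C, hC, h⟩ := exists_eventually_norm_pow_le x hr hx
  exact ⟨C, hC, h.self_of_nhds⟩

end PowerBound

/-! ### Power series in one and two variables -/

section PowerSeries

/-- Re-expansion of a power series around a point `z` of its disc of convergence. -/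
theorem hasSum_iteratedDeriv_of_hasSum {c : ℕ → ℂ} {g : ℂ → ℂ} {R : ℝ}
    (h : ∀ u ∈ Metric.ball (0 : ℂ) R, HasSum (fun i => c i * u ^ i) (g u))
    {z : ℂ} (hz : z ∈ Metric.ball (0 : ℂ) R) (q : ℕ) :
    HasSum (fun i : ℕ => (i.choose q : ℂ) * z ^ (i - q) * c i)
      (iteratedDeriv q g z / (q.factorial : ℂ)) := by
  have hzR : ‖z‖ < R := by simpa using hz
  -- `F w (i, q)` is the term of order `w ^ q` in the binomial expansion of `c i * (z + w) ^ i`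
  set F : ℂ → ℕ × ℕ → ℂ := fun w p => ((p.1.choose p.2 : ℂ) * z ^ (p.1 - p.2) * c p.1) * w ^ p.2
  have hbinom : ∀ (a b : ℝ) (i : ℕ),
      HasSum (fun q : ℕ => (i.choose q : ℝ) * a ^ (i - q) * b ^ q) ((a + b) ^ i) := by
    intro a b i
    rw [add_comm, add_pow]
    have : ∑ m ∈ Finset.range (i + 1), b ^ m * a ^ (i - m) * (i.choose m : ℝ) =
        ∑ m ∈ Finset.range (i + 1), (i.choose m : ℝ) * a ^ (i - m) * b ^ m :=
      Finset.sum_congr rfl fun _ _ => by ring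
    rw [this]
    refine hasSum_sum_of_ne_finset_zero fun m hm => ?_
    rw [Nat.choose_eq_zero_of_lt (by simpa using hm)]
    simp
  have hbinom' : ∀ (w : ℂ) (i : ℕ), HasSum (fun q : ℕ => F w (i, q)) (c i * (z + w) ^ i) := by
    intro w i
    have hf : c i * (z + w) ^ i = ∑ m ∈ Finset.range (i + 1), F w (i, m) := by
      rw [add_comm, add_pow, Finset.mul_sum]
      exact Finset.sum_congr rfl fun _ _ => by simp only [F]; ring
    rw [hf]
    refine hasSum_sum_of_ne_finset_zero fun m hm => ?_
    simp only [F]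
    rw [Nat.choose_eq_zero_of_lt (by simpa using hm)]
    simp
  have hsum : ∀ w : ℂ, ‖z‖ + ‖w‖ < R → Summable (F w) := by
    intro w hw
    have hs : Summable fun i => ‖c i‖ * (‖z‖ + ‖w‖) ^ i := by
      have h0 : 0 ≤ ‖z‖ + ‖w‖ := by positivity
      have := (h ((‖z‖ + ‖w‖ : ℝ) : ℂ) (by
        simpa only [mem_ball_zero_iff, Complex.norm_real, Real.norm_eq_abs, abs_of_nonneg h0]
          using hw)).summable.norm
      simpa only [norm_mul, norm_pow, Complex.norm_real, Real.norm_eq_abs, abs_of_nonneg h0]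
        using this
    have hn : ∀ i q, ‖F w (i, q)‖ =
        ‖c i‖ * ((i.choose q : ℝ) * ‖z‖ ^ (i - q) * ‖w‖ ^ q) := by
      intro i q
      simp only [F, norm_mul, norm_pow, Complex.norm_natCast]
      ring
    have hrow : ∀ i, HasSum (fun q => ‖F w (i, q)‖) (‖c i‖ * (‖z‖ + ‖w‖) ^ i) := by
      intro i
      simp only [hn]
      exact (hbinom _ _ i).mul_left _
    refine Summable.of_norm ((summable_prod_of_nonneg fun _ => norm_nonneg _).2
      ⟨fun i => (hrow i).summable, ?_⟩)
    simpa only [(hrow _).tsum_eq] using hs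
  -- collect the powers of `w`
  have hswap : ∀ w : ℂ, ‖z‖ + ‖w‖ < R →
      HasSum (fun q => ∑' i, F w (i, q)) (g (z + w)) := by
    intro w hw
    have h1 : HasSum (F w) (g (z + w)) := by
      have h2 := (hsum w hw).hasSum.prod_fiberwise (hbinom' w)
      rw [← h2.unique (h (z + w) (by
        rw [mem_ball_zero_iff]; exact (norm_add_le _ _).trans_lt hw))]
      exact (hsum w hw).hasSum
    refine HasSum.prod_fiberwise (f := fun p : ℕ × ℕ => F w p.swap)
      ((Equiv.prodComm ℕ ℕ).hasSum_iff.2 h1) fun q => ?_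
    exact ((hsum w hw).prod_symm.prod_factor q).hasSum
  set d : ℕ → ℂ := fun q => ∑' i : ℕ, (i.choose q : ℂ) * z ^ (i - q) * c i
  obtain ⟨ε, hε0, hε⟩ : ∃ ε : ℝ, 0 < ε ∧ ‖z‖ + ε < R :=
    ⟨(R - ‖z‖) / 2, by linarith, by linarith⟩
  have hd : Summable fun i : ℕ => (i.choose q : ℂ) * z ^ (i - q) * c i := by
    have h1 := (hsum (ε : ℂ) (by
      rwa [Complex.norm_real, Real.norm_eq_abs, abs_of_pos hε0])).prod_symm.prod_factor q
    have h2 : ((ε : ℂ) ^ q) ≠ 0 := pow_ne_zero _ (by exact_mod_cast hε0.ne')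
    exact (summable_mul_right_iff h2).1 h1
  have hps : HasFPowerSeriesOnBall g (FormalMultilinearSeries.ofScalars ℂ d) z
      (ENNReal.ofReal ε) := by
    have hser : ∀ w : ℂ, ‖w‖ ≤ ε → HasSum (fun q => d q * w ^ q) (g (z + w)) := by
      intro w hw
      have := hswap w (by linarith)
      simpa only [F, tsum_mul_right] using this
    refine ⟨?_, by simpa using hε0, fun {w} hw => ?_⟩
    · have h1 := (hser (ε : ℂ) (by
        rw [Complex.norm_real, Real.norm_eq_abs, abs_of_pos hε0])).summable.tendsto_atTop_zero
      have h2 := FormalMultilinearSeries.le_radius_of_tendsto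
        (FormalMultilinearSeries.ofScalars ℂ d) (r := ε.toNNReal) (l := 0) (by
          refine (tendsto_zero_iff_norm_tendsto_zero.1 h1).congr fun n => ?_
          rw [FormalMultilinearSeries.ofScalars_norm, Real.coe_toNNReal _ hε0.le, norm_mul,
            norm_pow, Complex.norm_real, Real.norm_eq_abs, abs_of_pos hε0])
      exact h2
    · have hw' : ‖w‖ < ε := by
        rw [Metric.mem_eball, edist_zero_right, ← ofReal_norm,
          ENNReal.ofReal_lt_ofReal_iff hε0] at hw
        exact hw
      simpa only [FormalMultilinearSeries.ofScalars_apply_eq, smul_eq_mul] using hser w hw'.le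
  have hfac := hps.factorial_smul (1 : ℂ) q
  have hdq : d q = iteratedDeriv q g z / (q.factorial : ℂ) := by
    rw [iteratedDeriv_eq_iteratedFDeriv, ← hfac]
    have : (q.factorial : ℂ) ≠ 0 := by exact_mod_cast q.factorial_ne_zero
    field_simp
    simp [mul_comm]
  rw [← hdq]
  exact hd.hasSum

/-- The coefficients `c i j` are those of a double power series converging for `|x|, |y| < R`:
Cauchy's estimates hold on every smaller bidisc. -/
def CauchyBounded (c : ℕ → ℕ → ℂ) (R : ℝ) : Prop :=
  ∀ s : ℝ, 0 < s → s < R → ∃ C : ℝ, ∀ i j, ‖c i j‖ * (s ^ i * s ^ j) ≤ C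

theorem CauchyBounded.summable {c : ℕ → ℕ → ℂ} {R r : ℝ} (hc : CauchyBounded c R) (hr : 0 ≤ r)
    (hrR : r < R) : Summable fun p : ℕ × ℕ => ‖c p.1 p.2‖ * (r ^ p.1 * r ^ p.2) := by
  obtain ⟨s, hrs, hsR⟩ := exists_between hrR
  have hs : 0 < s := hr.trans_lt hrs
  obtain ⟨C, hC⟩ := hc s hs hsR
  have hgeo : Summable fun i : ℕ => (r / s) ^ i :=
    summable_geometric_of_lt_one (by positivity) ((div_lt_one hs).2 hrs)
  have hgeo2 := (hgeo.mul_of_nonneg hgeo (fun _ => by positivity) fun _ => by positivity).mul_left C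
  refine Summable.of_nonneg_of_le (fun _ => by positivity) (fun p => ?_) hgeo2
  calc ‖c p.1 p.2‖ * (r ^ p.1 * r ^ p.2)
      = ‖c p.1 p.2‖ * (s ^ p.1 * s ^ p.2) * ((r / s) ^ p.1 * (r / s) ^ p.2) := by
        rw [div_pow, div_pow]; field_simp
    _ ≤ C * ((r / s) ^ p.1 * (r / s) ^ p.2) := by gcongr; exact hC _ _

theorem choose_mul_pow_le {x η r : ℝ} (hx : 0 ≤ x) (hη : 0 < η) (hr : x + η ≤ r) (i q : ℕ) :
    (i.choose q : ℝ) * x ^ (i - q) ≤ (η ^ q)⁻¹ * r ^ i := by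
  rw [← div_eq_inv_mul, le_div_iff₀ (by positivity)]
  refine le_trans ?_ (pow_le_pow_left₀ (by positivity) hr i)
  rcases lt_or_ge i q with h | h
  · rw [Nat.choose_eq_zero_of_lt h]
    simp only [Nat.cast_zero, zero_mul]
    positivity
  · rw [add_comm, add_pow]
    have := Finset.single_le_sum (f := fun m => η ^ m * x ^ (i - m) * (i.choose m : ℝ))
      (fun m _ => by positivity) (Finset.mem_range.2 (Nat.lt_succ_of_le h))
    refine le_trans (le_of_eq ?_) this
    ring

/-- Termwise differentiation of a double power series. -/
theorem hasSum_partialDeriv₂ {c : ℕ → ℕ → ℂ} {β : ℂ → ℂ → ℂ} {R : ℝ} (hc : CauchyBounded c R)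
    (hβ : ∀ x ∈ Metric.ball (0 : ℂ) R, ∀ y ∈ Metric.ball (0 : ℂ) R,
      HasSum (fun p : ℕ × ℕ => c p.1 p.2 * (x ^ p.1 * y ^ p.2)) (β x y))
    {x y : ℂ} (hx : x ∈ Metric.ball (0 : ℂ) R) (hy : y ∈ Metric.ball (0 : ℂ) R) (q₁ q₂ : ℕ) :
    HasSum (fun p : ℕ × ℕ => c p.1 p.2 * ((p.1.choose q₁ : ℂ) * x ^ (p.1 - q₁) *
        ((p.2.choose q₂ : ℂ) * y ^ (p.2 - q₂))))
      (partialDeriv₂ β q₁ q₂ x y / ((q₁.factorial : ℂ) * (q₂.factorial : ℂ))) := by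
  have hsum : ∀ u ∈ Metric.ball (0 : ℂ) R, ∀ q, Summable fun p : ℕ × ℕ =>
      c p.1 p.2 * ((p.1.choose q : ℂ) * u ^ (p.1 - q) *
        ((p.2.choose q₂ : ℂ) * y ^ (p.2 - q₂))) := by
    intro u hu q
    have hm : max ‖u‖ ‖y‖ < R := max_lt (by simpa using hu) (by simpa using hy)
    obtain ⟨r, hr, hrR⟩ := exists_between hm
    have hη : 0 < r - max ‖u‖ ‖y‖ := sub_pos.2 hr
    have hr0 : 0 ≤ r := ((norm_nonneg u).trans (le_max_left _ _)).trans hr.le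
    set η := r - max ‖u‖ ‖y‖ with hηdef
    refine Summable.of_norm_bounded ((hc.summable hr0 hrR).mul_left ((η ^ q)⁻¹ * (η ^ q₂)⁻¹))
      fun p => ?_
    have h1 := choose_mul_pow_le (norm_nonneg u) hη (r := r)
      (by linarith [le_max_left ‖u‖ ‖y‖]) p.1 q
    have h2 := choose_mul_pow_le (norm_nonneg y) hη (r := r)
      (by linarith [le_max_right ‖u‖ ‖y‖]) p.2 q₂
    calc _ = ‖c p.1 p.2‖ * (((p.1.choose q : ℝ) * ‖u‖ ^ (p.1 - q)) *
          ((p.2.choose q₂ : ℝ) * ‖y‖ ^ (p.2 - q₂))) := by simp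
      _ ≤ ‖c p.1 p.2‖ * (((η ^ q)⁻¹ * r ^ p.1) * ((η ^ q₂)⁻¹ * r ^ p.2)) := by gcongr
      _ = _ := by ring
  -- differentiate in the second variable, with the first one fixed
  have hinner : ∀ u ∈ Metric.ball (0 : ℂ) R,
      HasSum (fun p : ℕ × ℕ => c p.1 p.2 * (u ^ p.1 * ((p.2.choose q₂ : ℂ) * y ^ (p.2 - q₂))))
        (iteratedDeriv q₂ (fun v => β u v) y / (q₂.factorial : ℂ)) := by
    intro u hu
    have hrow : ∀ v ∈ Metric.ball (0 : ℂ) R, HasSum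
        (fun j => (∑' i, c i j * u ^ i) * v ^ j) (β u v) := by
      intro v hv
      refine HasSum.prod_fiberwise
        (f := fun p : ℕ × ℕ => c p.2 p.1 * (u ^ p.2 * v ^ p.1))
        ((Equiv.prodComm ℕ ℕ).hasSum_iff.2 (hβ u hu v hv)) fun j => ?_
      have := ((hβ u hu v hv).summable.prod_symm.prod_factor j).hasSum
      simp only [Prod.swap_prod_mk] at this
      rw [← tsum_mul_right]
      simpa only [mul_assoc] using this
    have h1 := hasSum_iteratedDeriv_of_hasSum hrow hy q₂
    have h2 := hsum u hu 0
    simp only [Nat.choose_zero_right, Nat.cast_one, one_mul, Nat.sub_zero] at h2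
    have h3 := HasSum.prod_fiberwise (f := fun p : ℕ × ℕ =>
      c p.2 p.1 * (u ^ p.2 * ((p.1.choose q₂ : ℂ) * y ^ (p.1 - q₂))))
      h2.prod_symm.hasSum (g := fun j => (j.choose q₂ : ℂ) * y ^ (j - q₂) * ∑' i, c i j * u ^ i)
      fun j => by
        rw [← tsum_mul_left]
        have := (h2.prod_symm.prod_factor j).hasSum
        simp only [Prod.swap_prod_mk] at this
        convert! this using 1
        exact tsum_congr fun _ => by ring
    rw [h1.unique h3]
    exact (Equiv.prodComm ℕ ℕ).hasSum_iff.1 h2.prod_symm.hasSum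
  -- collect the powers of the first variable and differentiate in it
  have hcol : ∀ u ∈ Metric.ball (0 : ℂ) R, HasSum
      (fun i => (∑' j, c i j * ((j.choose q₂ : ℂ) * y ^ (j - q₂))) * u ^ i)
      (iteratedDeriv q₂ (fun v => β u v) y / (q₂.factorial : ℂ)) := by
    intro u hu
    refine (hinner u hu).prod_fiberwise fun i => ?_
    have := ((hinner u hu).summable.prod_factor i).hasSum
    rw [← tsum_mul_right]
    convert! this using 1
    exact tsum_congr fun _ => by ring
  have h1 := hasSum_iteratedDeriv_of_hasSum hcol hx q₁
  have h2 := hsum x hx q₁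
  have h3 := h2.hasSum.prod_fiberwise
    (g := fun i => (i.choose q₁ : ℂ) * x ^ (i - q₁) *
      ∑' j, c i j * ((j.choose q₂ : ℂ) * y ^ (j - q₂))) fun i => by
    have := (h2.prod_factor i).hasSum
    rw [← tsum_mul_left]
    convert! this using 1
    exact tsum_congr fun _ => by ring
  have h4 : partialDeriv₂ β q₁ q₂ x y / ((q₁.factorial : ℂ) * (q₂.factorial : ℂ)) =
      iteratedDeriv q₁ (fun u => iteratedDeriv q₂ (fun v => β u v) y / (q₂.factorial : ℂ)) x /
        (q₁.factorial : ℂ) := by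
    rw [partialDeriv₂]
    simp only [div_eq_inv_mul]
    rw [iteratedDeriv_const_mul_field]
    rw [mul_inv]
    ring
  rw [h4, h1.unique h3]
  exact h2.hasSum

/-- The power series of `f^{[1]}`: the geometric sum `(xⁿ - yⁿ) / (x - y)` turns the coefficients
`aₙ` of `f` into the coefficients `a_{i+j+1}` of `x^i y^j`. -/
theorem exists_hasSum_dividedDiff₁ {f : ℂ → ℂ} {R : ℝ}
    (hf : AnalyticOnNhd ℂ f (Metric.ball 0 R)) :
    ∃ c : ℕ → ℕ → ℂ, CauchyBounded c R ∧
      ∀ x ∈ Metric.ball (0 : ℂ) R, ∀ y ∈ Metric.ball (0 : ℂ) R,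
        HasSum (fun p : ℕ × ℕ => c p.1 p.2 * (x ^ p.1 * y ^ p.2)) (dividedDiff₁ f x y) := by
  obtain ⟨a, hser⟩ : ∃ a : ℕ → ℂ, ∀ u ∈ Metric.ball (0 : ℂ) R,
      HasSum (fun n => a n * u ^ n) (f u) := by
    refine ⟨fun n => (n.factorial : ℂ)⁻¹ * iteratedDeriv n f 0, fun u hu => ?_⟩
    have := Complex.hasSum_taylorSeries_on_ball hf.differentiableOn hu
    convert! this using 2 with n
    simp only [smul_eq_mul, sub_zero]
    ring
  have hc : CauchyBounded (fun i j => a (i + j + 1)) R := by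
    intro s hs hsR
    have h1 := (hser (s : ℂ) (by
      simpa [abs_of_pos hs] using hsR)).summable.tendsto_atTop_zero.norm.bddAbove_range
    obtain ⟨C, hC⟩ := h1
    refine ⟨C / s, fun i j => ?_⟩
    rw [le_div_iff₀ hs]
    have := hC ⟨i + j + 1, rfl⟩
    simp only [norm_mul, norm_pow, Complex.norm_real, Real.norm_eq_abs, abs_of_pos hs] at this
    refine le_trans (le_of_eq ?_) this
    ring
  refine ⟨fun i j => a (i + j + 1), hc, fun x hx y hy => ?_⟩
  have hsum : Summable fun p : ℕ × ℕ => a (p.1 + p.2 + 1) * (x ^ p.1 * y ^ p.2) := by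
    have hm : max ‖x‖ ‖y‖ < R := max_lt (by simpa using hx) (by simpa using hy)
    refine Summable.of_norm_bounded
      (hc.summable ((norm_nonneg x).trans (le_max_left _ ‖y‖)) hm) fun p => ?_
    rw [norm_mul, norm_mul, norm_pow, norm_pow]
    gcongr
    · exact le_max_left _ _
    · exact le_max_right _ _
  have hdiag : HasSum (fun n => a (n + 1) * ∑ p ∈ Finset.HasAntidiagonal.antidiagonal n, x ^ p.1 * y ^ p.2)
      (∑' p : ℕ × ℕ, a (p.1 + p.2 + 1) * (x ^ p.1 * y ^ p.2)) := by
    have h1 := (Finset.HasAntidiagonal.sigmaAntidiagonalEquivProd (A := ℕ)).hasSum_iff.2 hsum.hasSum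
    refine h1.sigma fun n => ?_
    have h2 := hasSum_fintype (fun p : Finset.HasAntidiagonal.antidiagonal n =>
      a (p.1.1 + p.1.2 + 1) * (x ^ p.1.1 * y ^ p.1.2))
    convert! h2 using 1
    rw [Finset.mul_sum, ← Finset.sum_coe_sort (Finset.HasAntidiagonal.antidiagonal n)]
    refine Finset.sum_congr rfl fun p _ => ?_
    rw [Finset.HasAntidiagonal.mem_antidiagonal.1 p.2]
  convert! hsum.hasSum using 1
  refine HasSum.unique ?_ hdiag
  have hgeom : ∀ n, ∑ p ∈ Finset.HasAntidiagonal.antidiagonal n, x ^ p.1 * y ^ p.2 =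
      ∑ i ∈ Finset.range (n + 1), x ^ i * y ^ (n - i) := fun n =>
    Finset.Nat.sum_antidiagonal_eq_sum_range_succ (fun i j => x ^ i * y ^ j) n
  simp only [hgeom]
  rw [dividedDiff₁]
  split_ifs with hxy
  · subst hxy
    have h1 := hasSum_iteratedDeriv_of_hasSum hser hx 1
    rw [iteratedDeriv_one, Nat.factorial_one, Nat.cast_one, div_one,
      ← hasSum_nat_add_iff' 1] at h1
    simp only [Finset.range_one, Finset.sum_singleton, Nat.choose_zero_succ, Nat.cast_zero,
      zero_mul, sub_zero] at h1
    convert! h1 using 2 with n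
    rw [Finset.sum_congr rfl fun i hi => show x ^ i * x ^ (n - i) = x ^ n by
      rw [← pow_add, Nat.add_sub_cancel' (Nat.lt_succ_iff.1 (Finset.mem_range.1 hi))]]
    simp
    ring
  · have hne : x - y ≠ 0 := sub_ne_zero.2 hxy
    have h1 := ((hser x hx).sub (hser y hy)).div_const (x - y)
    rw [← hasSum_nat_add_iff' 1] at h1
    simp only [Finset.range_one, Finset.sum_singleton, pow_zero, sub_self, zero_div,
      sub_zero] at h1
    convert! h1 using 2 with n
    rw [eq_div_iff hne, mul_assoc, ← mul_sub]
    congr 1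
    exact Commute.geom_sum₂_mul (Commute.all x y) (n + 1)

end PowerSeries

/-! ### Fine partitions -/

section Partitions

variable {s : Set ℂ}

theorem TaggedPartition.pairwiseDisjoint (P : TaggedPartition s) :
    (P.cells.parts : Set (Set ℂ)).PairwiseDisjoint id :=
  Finset.supIndep_iff_pairwiseDisjoint.1 P.cells.supIndep

theorem TaggedPartition.subset (P : TaggedPartition s) {A : Set ℂ} (hA : A ∈ P.cells.parts) :
    A ⊆ s := P.cells.le hA

theorem TaggedPartition.tag_mem_set (P : TaggedPartition s) {A : Set ℂ}
    (hA : A ∈ P.cells.parts) : P.tag A ∈ s :=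
  P.subset hA (P.tag_mem A hA)

theorem eventually_le_cells (Q : TaggedPartition s) :
    ∀ᶠ P in refinement s, P.cells ≤ Q.cells :=
  mem_iInf_of_mem Q (mem_principal_self _)

/-- Along refinement, a Borel function with finitely many values on `s` is eventually constant on
the cells: refine the partition into its level sets. -/
theorem eventually_constant_on_cells {ι : Type*} [MeasurableSpace ι] [MeasurableSingletonClass ι]
    (hs : MeasurableSet s) {g : ℂ → ι} (hg : Measurable g) (hfin : (g '' s).Finite) :
    ∀ᶠ P in refinement s, ∀ A ∈ P.cells.parts, ∀ z ∈ A, ∀ w ∈ A, g z = g w := by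
  classical
  set parts : Finset (Set ℂ) := hfin.toFinset.image fun i => s ∩ g ⁻¹' {i} with hparts
  have hdisj : (parts : Set (Set ℂ)).PairwiseDisjoint id := by
    intro A hA B hB hAB
    simp only [hparts, Finset.coe_image, Set.mem_image] at hA hB
    obtain ⟨i, -, rfl⟩ := hA
    obtain ⟨j, -, rfl⟩ := hB
    refine Set.disjoint_left.2 fun z hz hz' => hAB ?_
    have hi : g z = i := hz.2
    have hj : g z = j := hz'.2
    rw [← hi, ← hj]
  have hsup : parts.sup id = s := by
    rw [Finset.sup_eq_iSup]
    ext z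
    simp only [hparts, Set.iSup_eq_iUnion, Set.mem_iUnion, Finset.mem_image, Set.Finite.mem_toFinset,
      id, exists_prop]
    constructor
    · rintro ⟨A, ⟨i, -, rfl⟩, hz⟩
      exact hz.1
    · intro hz
      exact ⟨_, ⟨g z, ⟨z, hz, rfl⟩, rfl⟩, hz, rfl⟩
  obtain ⟨Q, hQ⟩ := exists_tagged
    (Finpartition.ofErase parts (Finset.supIndep_iff_pairwiseDisjoint.2 hdisj) hsup) (by
      intro A hA
      have hA' := Finset.mem_of_mem_erase hA
      simp only [hparts, Finset.mem_image] at hA'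
      obtain ⟨i, -, rfl⟩ := hA'
      exact hs.inter (hg (measurableSet_singleton i)))
  filter_upwards [eventually_le_cells Q] with P hP A hA z hz w hw
  obtain ⟨B, hB, hAB⟩ := hP hA
  rw [hQ] at hB
  have hB' := Finset.mem_of_mem_erase hB
  simp only [hparts, Finset.mem_image] at hB'
  obtain ⟨i, -, rfl⟩ := hB'
  have h1 : g z = i := (hAB hz).2
  have h2 : g w = i := (hAB hw).2
  rw [h1, h2]

/-- Along refinement, the mesh of the partitions tends to `0`. -/
theorem eventually_mesh_le (hs : MeasurableSet s) (hb : Bornology.IsBounded s) {δ : ℝ}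
    (hδ : 0 < δ) :
    ∀ᶠ P in refinement s, ∀ A ∈ P.cells.parts, ∀ z ∈ A, ∀ w ∈ A, ‖z - w‖ ≤ δ := by
  obtain ⟨r, hr⟩ := hb.exists_norm_le
  -- two points in the same square of a grid of width `δ / 2` are at distance at most `δ`
  have hfl : ∀ φ : ℂ → ℝ, Measurable φ → (∀ z, |φ z| ≤ ‖z‖) →
      ∀ᶠ P in refinement s, ∀ A ∈ P.cells.parts, ∀ z ∈ A, ∀ w ∈ A,
        ⌊φ z / (δ / 2)⌋ = ⌊φ w / (δ / 2)⌋ := by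
    intro φ hφ hφn
    refine eventually_constant_on_cells hs (g := fun z => ⌊φ z / (δ / 2)⌋)
      (Int.measurable_floor.comp (hφ.div_const _)) ?_
    refine (Set.finite_Icc ⌊-r / (δ / 2)⌋ ⌊r / (δ / 2)⌋).subset ?_
    rintro _ ⟨z, hz, rfl⟩
    have := abs_le.1 ((hφn z).trans (hr z hz))
    constructor
    · exact Int.floor_le_floor (by gcongr; exact this.1)
    · exact Int.floor_le_floor (by gcongr; exact this.2)
  filter_upwards [hfl Complex.re Complex.measurable_re Complex.abs_re_le_norm,
    hfl Complex.im Complex.measurable_im Complex.abs_im_le_norm] with P hre him A hA z hz w hw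
  have h1 := Int.abs_sub_lt_one_of_floor_eq_floor (hre A hA z hz w hw)
  have h2 := Int.abs_sub_lt_one_of_floor_eq_floor (him A hA z hz w hw)
  rw [← sub_div, abs_div, abs_of_pos (half_pos hδ), div_lt_one (half_pos hδ)] at h1 h2
  refine (Complex.norm_le_abs_re_add_abs_im _).trans ?_
  rw [Complex.sub_re, Complex.sub_im]
  linarith

end Partitions

/-! ### Riemann sums of the scalar part -/

section SpectralDecomposition

variable {H : Type*} [NormedAddCommGroup H] [InnerProductSpace ℂ H] {X : H →L[ℂ] H}

theorem measurableSet_spectrum [CompleteSpace H] (X : H →L[ℂ] H) : MeasurableSet (spectrum ℂ X) :=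
  (spectrum.isClosed X).measurableSet

namespace SpectralDecomposition

theorem E_mul_of_subset (D : SpectralDecomposition X) {A B : Set ℂ} (hA : MeasurableSet A)
    (hB : MeasurableSet B) (h : B ⊆ A) : D.E A * D.E B = D.E B := by
  rw [← D.E_inter A B hA hB, Set.inter_eq_right.2 h]

theorem E_mul_of_disjoint (D : SpectralDecomposition X) {A B : Set ℂ} (hA : MeasurableSet A)
    (hB : MeasurableSet B) (h : Disjoint A B) : D.E A * D.E B = 0 := by
  rw [← D.E_inter A B hA hB, h.inter_eq, D.E_empty]

theorem E_parts_mul (D : SpectralDecomposition X) (P : TaggedPartition (spectrum ℂ X))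
    {A B : Set ℂ} (hA : A ∈ P.cells.parts) (hB : MeasurableSet B) (h : B ⊆ A)
    [DecidableEq (Set ℂ)] {A' : Set ℂ} (hA' : A' ∈ P.cells.parts) :
    D.E A' * D.E B = if A' = A then D.E B else 0 := by
  split_ifs with hAA
  · subst hAA
    exact D.E_mul_of_subset (P.measurableSet_of_mem _ hA) hB h
  · exact D.E_mul_of_disjoint (P.measurableSet_of_mem _ hA') hB
      ((P.pairwiseDisjoint hA' hA hAA).mono_right h)

theorem sum_E_parts (D : SpectralDecomposition X) (P : TaggedPartition (spectrum ℂ X)) :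
    ∑ A ∈ P.cells.parts, D.E A = 1 := by
  classical
  have hunion : ∀ F : Finset (Set ℂ), (∀ A ∈ F, MeasurableSet A) →
      (F : Set (Set ℂ)).PairwiseDisjoint id → ∑ A ∈ F, D.E A = D.E (F.sup id) := by
    intro F hm hd
    ext x
    have h1 := (D.vectorMeasure x).of_biUnion_finset (s := F) (f := id) hd hm
    have h2 : (⋃ b ∈ F, id b) = F.sup id := by rw [Finset.sup_eq_iSup]; rfl
    rw [h2, D.vectorMeasure_apply x (by
      rw [← h2]; exact Finset.measurableSet_biUnion F hm)] at h1
    rw [h1, sum_apply]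
    exact Finset.sum_congr rfl fun A hA => (D.vectorMeasure_apply x (hm A hA)).symm
  rw [hunion _ P.measurableSet_of_mem P.pairwiseDisjoint, P.cells.sup_parts, D.E_spectrum]

theorem commute_S [CompleteSpace H] (D : SpectralDecomposition X) : Commute X D.S := by
  have := refinement_neBot (measurableSet_spectrum X)
  have h : ∀ P : TaggedPartition (spectrum ℂ X),
      X * ∑ A ∈ P.cells.parts, P.tag A • D.E A = (∑ A ∈ P.cells.parts, P.tag A • D.E A) * X := by
    intro P
    rw [Finset.mul_sum, Finset.sum_mul]
    refine Finset.sum_congr rfl fun A hA => ?_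
    rw [mul_smul_comm, smul_mul_assoc, (D.commute_E A (P.measurableSet_of_mem A hA)).eq]
  refine tendsto_nhds_unique (D.tendsto_S.const_mul X) ?_
  simpa only [h] using D.tendsto_S.mul_const X

/-- On a cell, the Riemann sum of `S` is multiplication by the tag. -/
theorem sub_pow_mul_E (D : SpectralDecomposition X) (P : TaggedPartition (spectrum ℂ X))
    {B : Set ℂ} (hB : B ∈ P.cells.parts) (t : ℂ) (k : ℕ) :
    (∑ A ∈ P.cells.parts, P.tag A • D.E A - t • (1 : H →L[ℂ] H)) ^ k * D.E B =
      (P.tag B - t) ^ k • D.E B := by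
  classical
  have h1 : (∑ A ∈ P.cells.parts, P.tag A • D.E A) * D.E B = P.tag B • D.E B := by
    rw [Finset.sum_mul, Finset.sum_eq_single B]
    · rw [smul_mul_assoc, D.E_parts_mul P hB (P.measurableSet_of_mem B hB) subset_rfl hB,
        if_pos rfl]
    · intro A hA hAB
      rw [smul_mul_assoc, D.E_parts_mul P hB (P.measurableSet_of_mem B hB) subset_rfl hA,
        if_neg hAB, smul_zero]
    · exact fun h => (h hB).elim
  induction k with
  | zero => simp
  | succ k ih =>
    rw [pow_succ, mul_assoc, sub_mul, h1, smul_mul_assoc, one_mul, ← sub_smul, mul_smul_comm, ih,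
      smul_smul, pow_succ, mul_comm]

/-- The operators `∑ c_A (S - t_A)^k E(A)` are the integrals of functions bounded by
`sup |c_A| * mesh ^ k`, so they are bounded accordingly. -/
theorem exists_norm_sum_sub_pow_le [CompleteSpace H] (D : SpectralDecomposition X) :
    ∃ M : ℝ, 0 ≤ M ∧ ∀ (P : TaggedPartition (spectrum ℂ X)) (c : Set ℂ → ℂ) (κ δ : ℝ),
      0 ≤ κ → 0 ≤ δ → (∀ A ∈ P.cells.parts, ‖c A‖ ≤ κ) →
      (∀ A ∈ P.cells.parts, ∀ z ∈ A, ∀ w ∈ A, ‖z - w‖ ≤ δ) → ∀ k : ℕ,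
      ‖∑ A ∈ P.cells.parts, c A • ((D.S - P.tag A • (1 : H →L[ℂ] H)) ^ k * D.E A)‖ ≤
        M * (κ * δ ^ k) := by
  classical
  obtain ⟨M, hM0, hM⟩ := D.toProjectionMeasure.exists_norm_sum_le
  refine ⟨M, hM0, fun P c κ δ hκ hδ hc hmesh k => ?_⟩
  have := refinement_neBot (measurableSet_spectrum X)
  have hlim : Tendsto (fun Q : TaggedPartition (spectrum ℂ X) => ∑ A ∈ P.cells.parts,
      c A • ((∑ B ∈ Q.cells.parts, Q.tag B • D.E B - P.tag A • (1 : H →L[ℂ] H)) ^ k * D.E A))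
      (refinement (spectrum ℂ X)) (𝓝 (∑ A ∈ P.cells.parts,
        c A • ((D.S - P.tag A • (1 : H →L[ℂ] H)) ^ k * D.E A))) :=
    tendsto_finsetSum _ fun A _ =>
      ((((D.tendsto_S.sub_const _).pow k).mul_const _).const_smul _)
  refine le_of_tendsto hlim.norm ?_
  filter_upwards [eventually_le_cells P] with Q hQ
  have hpar : ∀ B ∈ Q.cells.parts, ∃ A ∈ P.cells.parts, B ⊆ A := fun B hB => hQ hB
  choose! p hp hpB using hpar
  have key : ∑ A ∈ P.cells.parts,
      c A • ((∑ B ∈ Q.cells.parts, Q.tag B • D.E B - P.tag A • (1 : H →L[ℂ] H)) ^ k * D.E A) =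
      ∑ B ∈ Q.cells.parts, (c (p B) * (Q.tag B - P.tag (p B)) ^ k) • D.E B := by
    refine (mul_one _).symm.trans ?_
    nth_rewrite 2 [← D.sum_E_parts Q]
    rw [Finset.mul_sum]
    refine Finset.sum_congr rfl fun B hB => ?_
    rw [Finset.sum_mul, Finset.sum_eq_single (p B)]
    · rw [smul_mul_assoc, mul_assoc, D.E_parts_mul P (hp B hB) (Q.measurableSet_of_mem B hB)
        (hpB B hB) (hp B hB), if_pos rfl, D.sub_pow_mul_E Q hB, smul_smul]
    · intro A hA hAB
      rw [smul_mul_assoc, mul_assoc, D.E_parts_mul P (hp B hB) (Q.measurableSet_of_mem B hB)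
        (hpB B hB) hA, if_neg hAB, mul_zero, smul_zero]
    · exact fun h => (h (hp B hB)).elim
  rw [key]
  refine hM _ Q.measurableSet_of_mem Q.pairwiseDisjoint _ _ (by positivity) fun B hB => ?_
  rw [norm_mul, norm_pow]
  gcongr
  · exact hc _ (hp B hB)
  · exact hmesh _ (hp B hB) _ (hpB B hB (Q.tag_mem B hB)) _ (P.tag_mem _ (hp B hB))

end SpectralDecomposition

end SpectralDecomposition

/-! ### Riemann sums of the powers -/

namespace SpectralDecomposition

variable {H : Type*} [NormedAddCommGroup H] [InnerProductSpace ℂ H] [CompleteSpace H]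
  {X : H →L[ℂ] H}

/-- The binomial expansion of `(X - t)^q = ((X - S) + (S - t))^q` in sums over a partition. -/
theorem sum_sub_pow_eq (D : SpectralDecomposition X) (P : TaggedPartition (spectrum ℂ X))
    (c : Set ℂ → ℂ) (q : ℕ) :
    ∑ A ∈ P.cells.parts, c A • ((X - P.tag A • (1 : H →L[ℂ] H)) ^ q * D.E A) =
      ∑ k ∈ Finset.range (q + 1), (q.choose k : ℂ) • ((X - D.S) ^ (q - k) *
        ∑ A ∈ P.cells.parts, c A • ((D.S - P.tag A • (1 : H →L[ℂ] H)) ^ k * D.E A)) := by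
  simp only [Finset.mul_sum, Finset.smul_sum]
  rw [Finset.sum_comm]
  refine Finset.sum_congr rfl fun A _ => ?_
  have hcomm : Commute (D.S - P.tag A • (1 : H →L[ℂ] H)) (X - D.S) := by
    have h1 : Commute D.S (X - D.S) := D.commute_S.symm.sub_right (Commute.refl _)
    exact h1.sub_left ((Commute.one_left _).smul_left _)
  have hX : X - P.tag A • (1 : H →L[ℂ] H) = (D.S - P.tag A • (1 : H →L[ℂ] H)) + (X - D.S) := by
    abel
  rw [hX, hcomm.add_pow, Finset.sum_mul, Finset.smul_sum]
  refine Finset.sum_congr rfl fun k _ => ?_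
  rw [(hcomm.pow_pow k (q - k)).eq, mul_smul_comm, smul_comm, ← mul_assoc,
    ← nsmul_eq_mul', smul_mul_assoc, Nat.cast_smul_eq_nsmul]

/-- On fine partitions `X - t` restricted to a cell is a small operator plus the quasi-nilpotent
`X - S`, so its powers decay faster than any prescribed geometric rate. -/
theorem exists_eventually_norm_sum_le (D : SpectralDecomposition X) {η : ℝ} (hη : 0 < η) :
    ∃ C : ℝ, 0 ≤ C ∧ ∀ᶠ P in refinement (spectrum ℂ X), ∀ (c : Set ℂ → ℂ) (κ : ℝ), 0 ≤ κ →
      (∀ A ∈ P.cells.parts, ‖c A‖ ≤ κ) → ∀ q : ℕ,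
      ‖∑ A ∈ P.cells.parts, c A • ((X - P.tag A • (1 : H →L[ℂ] H)) ^ q * D.E A)‖ ≤
        C * (κ * η ^ q) := by
  obtain ⟨M, hM0, hM⟩ := D.exists_norm_sum_sub_pow_le
  obtain ⟨C, hC0, hC⟩ := exists_norm_pow_le (X - D.S) (half_pos hη) (by
    rw [D.quasinilpotent]; simpa using hη)
  refine ⟨C * M, by positivity, ?_⟩
  filter_upwards [eventually_mesh_le (measurableSet_spectrum X) (spectrum.isBounded X)
    (half_pos hη)] with P hP c κ hκ hc q
  rw [D.sum_sub_pow_eq]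
  refine (norm_sum_le _ _).trans ?_
  calc _ ≤ ∑ k ∈ Finset.range (q + 1),
        (q.choose k : ℝ) * ((C * (η / 2) ^ (q - k)) * (M * (κ * (η / 2) ^ k))) := by
        refine Finset.sum_le_sum fun k _ => ?_
        rw [norm_smul, Complex.norm_natCast]
        refine mul_le_mul_of_nonneg_left ((norm_mul_le _ _).trans ?_) (Nat.cast_nonneg _)
        gcongr
        · exact hC _
        · exact hM P c κ (η / 2) hκ (half_pos hη).le hc hP k
    _ = C * M * (κ * η ^ q) := by
        have : η ^ q = (η / 2 + η / 2) ^ q := by rw [add_halves]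
        rw [this, add_pow, Finset.mul_sum, Finset.mul_sum]
        exact Finset.sum_congr rfl fun k _ => by ring

/-- The terms `(X - t)^q` with `q` at least the order of nilpotency vanish in the limit: of the
binomial expansion, the part `(X - S)^q` is exactly `0` on partitions that resolve the levels of
`min m (q + 1)`, and every other part contains a power of the mesh. -/
theorem tendsto_sum_of_m_le (D : SpectralDecomposition X) (q : ℕ)
    (c : TaggedPartition (spectrum ℂ X) → Set ℂ → ℂ) (κ : ℝ)
    (hc : ∀ P, ∀ A ∈ P.cells.parts, ‖c P A‖ ≤ κ)
    (hc0 : ∀ P, ∀ A ∈ P.cells.parts, q < D.m (P.tag A) → c P A = 0) :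
    Tendsto (fun P => ∑ A ∈ P.cells.parts,
      c P A • ((X - P.tag A • (1 : H →L[ℂ] H)) ^ q * D.E A)) (refinement (spectrum ℂ X)) (𝓝 0) := by
  simp only [D.sum_sub_pow_eq]
  rw [← Finset.sum_const_zero (s := Finset.range (q + 1))]
  refine tendsto_finsetSum _ fun k _ => ?_
  rcases k.eq_zero_or_pos with rfl | hk
  · refine tendsto_const_nhds.congr' ?_
    have hlev := eventually_constant_on_cells (measurableSet_spectrum X)
      (g := fun z => min (D.m z) (q + 1)) (D.measurable_m.min measurable_const)
      ((Set.finite_Iic (q + 1)).subset (by rintro _ ⟨z, -, rfl⟩; exact min_le_right (D.m z) (q + 1)))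
    filter_upwards [hlev] with P hP
    rw [Finset.mul_sum, Finset.sum_eq_zero, smul_zero]
    intro A hA
    rcases lt_or_ge q (D.m (P.tag A)) with h | h
    · rw [hc0 P A hA h, zero_smul, mul_zero]
    · have hsub : A ⊆ {z | D.m z ≤ q} := by
        intro z hz
        have := hP A hA z hz _ (P.tag_mem A hA)
        simp only [Set.mem_ofPred_eq]
        omega
      rw [pow_zero, one_mul, mul_smul_comm, Nat.sub_zero,
        ← D.E_mul_of_subset (measurableSet_le D.measurable_m measurable_const)
          (P.measurableSet_of_mem A hA) hsub, ← mul_assoc, D.nilpotent, zero_mul, smul_zero]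
  · obtain ⟨M, hM0, hM⟩ := D.exists_norm_sum_sub_pow_le
    have hκ : 0 ≤ |κ| := abs_nonneg κ
    set L : ℝ := (q.choose k : ℝ) * (‖(X - D.S) ^ (q - k)‖ * (M * |κ|)) with hL
    have hL0 : 0 ≤ L := by positivity
    rw [Metric.tendsto_nhds]
    intro ε hε
    set δ : ℝ := min 1 (ε / (2 * (L + 1))) with hδ
    have hδ0 : 0 < δ := by positivity
    filter_upwards [eventually_mesh_le (measurableSet_spectrum X) (spectrum.isBounded X)
      hδ0] with P hP
    rw [dist_zero_right, norm_smul, Complex.norm_natCast]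
    have hδk : δ ^ k ≤ δ := pow_le_of_le_one hδ0.le (min_le_left _ _) hk.ne'
    calc _ ≤ (q.choose k : ℝ) * (‖(X - D.S) ^ (q - k)‖ * (M * (|κ| * δ ^ k))) := by
          refine mul_le_mul_of_nonneg_left ((norm_mul_le _ _).trans ?_) (Nat.cast_nonneg _)
          gcongr
          exact hM P (c P) |κ| δ hκ hδ0.le (fun A hA => (hc P A hA).trans (le_abs_self κ)) hP k
      _ = L * δ ^ k := by rw [hL]; ring
      _ ≤ (L + 1) * δ := by gcongr; linarith
      _ ≤ (L + 1) * (ε / (2 * (L + 1))) := by gcongr; exact min_le_right _ _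
      _ = ε / 2 := by field_simp
      _ < ε := half_lt_self hε

/-- The Riemann sum of the single integral `∫ ∑_{q < m_λ} (λ^i)^{(q)} / q! (X - λ)^q dE(λ)`, whose
value is `X ^ i`. -/
noncomputable def powSum (D : SpectralDecomposition X) (P : TaggedPartition (spectrum ℂ X))
    (i : ℕ) : H →L[ℂ] H :=
  ∑ A ∈ P.cells.parts, ∑ q ∈ Finset.range (D.m (P.tag A)),
    ((i.choose q : ℂ) * P.tag A ^ (i - q)) • ((X - P.tag A • (1 : H →L[ℂ] H)) ^ q * D.E A)

omit [CompleteSpace H] in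
theorem powSum_eq (D : SpectralDecomposition X) (P : TaggedPartition (spectrum ℂ X)) (i : ℕ) :
    D.powSum P i = ∑ q ∈ Finset.range (i + 1), (i.choose q : ℂ) • ∑ A ∈ P.cells.parts,
      (if q < D.m (P.tag A) then P.tag A ^ (i - q) else 0) •
        ((X - P.tag A • (1 : H →L[ℂ] H)) ^ q * D.E A) := by
  simp only [Finset.smul_sum]
  rw [Finset.sum_comm, powSum]
  refine Finset.sum_congr rfl fun A _ => ?_
  have h1 : ∀ n, ∑ q ∈ Finset.range n, (i.choose q : ℂ) •
      (if q < D.m (P.tag A) then P.tag A ^ (i - q) else 0) •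
        ((X - P.tag A • (1 : H →L[ℂ] H)) ^ q * D.E A) =
      ∑ q ∈ (Finset.range n).filter (· < D.m (P.tag A)),
        ((i.choose q : ℂ) * P.tag A ^ (i - q)) •
          ((X - P.tag A • (1 : H →L[ℂ] H)) ^ q * D.E A) := by
    intro n
    rw [Finset.sum_filter]
    refine Finset.sum_congr rfl fun q _ => ?_
    split_ifs
    · rw [smul_smul]
    · rw [zero_smul, smul_zero]
  rw [h1]
  refine (Finset.sum_subset (fun q hq => ?_) fun q hq hq' => ?_).symm
  · exact Finset.mem_range.2 (Finset.mem_filter.1 hq).2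
  · simp only [Finset.mem_filter, Finset.mem_range] at hq hq'
    rw [Nat.choose_eq_zero_of_lt (by omega), Nat.cast_zero, zero_mul, zero_smul]

omit [CompleteSpace H] in
theorem pow_eq_sum (D : SpectralDecomposition X) (P : TaggedPartition (spectrum ℂ X)) (i : ℕ) :
    X ^ i = ∑ q ∈ Finset.range (i + 1), (i.choose q : ℂ) • ∑ A ∈ P.cells.parts,
      P.tag A ^ (i - q) • ((X - P.tag A • (1 : H →L[ℂ] H)) ^ q * D.E A) := by
  simp only [Finset.smul_sum]
  rw [Finset.sum_comm, ← mul_one (X ^ i), ← D.sum_E_parts P, Finset.mul_sum]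
  refine Finset.sum_congr rfl fun A _ => ?_
  have hcomm : Commute (X - P.tag A • (1 : H →L[ℂ] H)) (P.tag A • (1 : H →L[ℂ] H)) :=
    (Commute.one_right _).smul_right _
  rw [D.sum_E_parts P]
  have hX := hcomm.add_pow i
  rw [sub_add_cancel] at hX
  rw [hX, Finset.sum_mul]
  refine Finset.sum_congr rfl fun q _ => ?_
  rw [smul_pow, one_pow, mul_smul_comm, mul_one, smul_mul_assoc, smul_mul_assoc, ← nsmul_eq_mul',
    smul_mul_assoc, ← Nat.cast_smul_eq_nsmul ℂ, smul_comm]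

theorem tendsto_powSum (D : SpectralDecomposition X) (i : ℕ) :
    Tendsto (fun P => D.powSum P i) (refinement (spectrum ℂ X)) (𝓝 (X ^ i)) := by
  obtain ⟨ρ, hρ⟩ := (spectrum.isBounded (𝕜 := ℂ) X).exists_norm_le
  have hdiff : ∀ P, D.powSum P i = X ^ i - ∑ q ∈ Finset.range (i + 1), (i.choose q : ℂ) •
      ∑ A ∈ P.cells.parts, (if q < D.m (P.tag A) then 0 else P.tag A ^ (i - q)) •
        ((X - P.tag A • (1 : H →L[ℂ] H)) ^ q * D.E A) := by
    intro P
    rw [D.powSum_eq, D.pow_eq_sum P, ← Finset.sum_sub_distrib]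
    refine Finset.sum_congr rfl fun q _ => ?_
    rw [← smul_sub, ← Finset.sum_sub_distrib]
    congr 1
    refine Finset.sum_congr rfl fun A _ => ?_
    split_ifs <;> simp
  simp only [hdiff]
  have : Tendsto (fun P : TaggedPartition (spectrum ℂ X) =>
      ∑ q ∈ Finset.range (i + 1), (i.choose q : ℂ) •
      ∑ A ∈ P.cells.parts, (if q < D.m (P.tag A) then 0 else P.tag A ^ (i - q)) •
        ((X - P.tag A • (1 : H →L[ℂ] H)) ^ q * D.E A)) (refinement (spectrum ℂ X)) (𝓝 0) := by
    rw [← Finset.sum_const_zero (M := H →L[ℂ] H) (s := Finset.range (i + 1))]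
    refine tendsto_finsetSum _ fun q _ => ?_
    rw [← smul_zero (A := H →L[ℂ] H) (i.choose q : ℂ)]
    refine (D.tendsto_sum_of_m_le q
      (fun P A => if q < D.m (P.tag A) then 0 else P.tag A ^ (i - q)) (|ρ| ^ (i - q)) ?_ ?_).const_smul _
    · intro P A hA
      split_ifs
      · simp only [norm_zero]; positivity
      · rw [norm_pow]
        gcongr
        exact (hρ _ (P.tag_mem_set hA)).trans (le_abs_self ρ)
    · intro P A _ h
      exact if_pos h
  have h := (tendsto_const_nhds (x := X ^ i)).sub this
  rwa [sub_zero] at h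

theorem exists_norm_le_of_spectrum_subset {R : ℝ} (hR : 0 < R)
    (hX : spectrum ℂ X ⊆ Metric.ball 0 R) :
    ∃ ρ : ℝ, 0 ≤ ρ ∧ ρ < R ∧ ∀ z ∈ spectrum ℂ X, ‖z‖ ≤ ρ := by
  rcases (spectrum ℂ X).eq_empty_or_nonempty with h | h
  · exact ⟨0, le_rfl, hR, by simp [h]⟩
  · obtain ⟨z, hz, hmax⟩ := (spectrum.isCompact (𝕜 := ℂ) X).exists_isMaxOn h
      continuous_norm.continuousOn
    exact ⟨‖z‖, norm_nonneg z, by simpa using hX hz, fun w hw => hmax hw⟩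

/-- The Riemann sums of `X ^ i` obey, uniformly in `i`, the same kind of bound as `X ^ i`. -/
theorem exists_eventually_norm_powSum_le (D : SpectralDecomposition X) {R : ℝ} (hR : 0 < R)
    (hX : spectrum ℂ X ⊆ Metric.ball 0 R) :
    ∃ r C : ℝ, 0 ≤ r ∧ r < R ∧ 0 ≤ C ∧ ∀ᶠ P in refinement (spectrum ℂ X), ∀ i : ℕ,
      ‖D.powSum P i‖ ≤ C * r ^ i := by
  obtain ⟨ρ, hρ0, hρR, hρ⟩ := exists_norm_le_of_spectrum_subset hR hX
  obtain ⟨η, hη0, hη⟩ : ∃ η : ℝ, 0 < η ∧ ρ + η < R := ⟨(R - ρ) / 2, by linarith, by linarith⟩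
  obtain ⟨C, hC0, hC⟩ := D.exists_eventually_norm_sum_le hη0
  refine ⟨ρ + η, C, by positivity, hη, hC0, ?_⟩
  filter_upwards [hC] with P hP i
  rw [D.powSum_eq]
  refine (norm_sum_le _ _).trans ?_
  calc _ ≤ ∑ q ∈ Finset.range (i + 1), (i.choose q : ℝ) * (C * (ρ ^ (i - q) * η ^ q)) := by
        refine Finset.sum_le_sum fun q _ => ?_
        rw [norm_smul, Complex.norm_natCast]
        refine mul_le_mul_of_nonneg_left (hP _ _ (by positivity) (fun A hA => ?_) q)
          (Nat.cast_nonneg _)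
        split_ifs
        · rw [norm_pow]
          exact pow_le_pow_left₀ (norm_nonneg _) (hρ _ (P.tag_mem_set hA)) _
        · simp only [norm_zero]; positivity
    _ = C * (ρ + η) ^ i := by
        rw [add_comm ρ, add_pow, Finset.mul_sum]
        exact Finset.sum_congr rfl fun q _ => by ring

end SpectralDecomposition

/-! ### Double power series of operators -/

section DoubleSeries

variable {H : Type*} [NormedAddCommGroup H] [InnerProductSpace ℂ H]

/-- The double power series `∑ c i j x^i y^j` evaluated at left multiplication by `X₁` and right
multiplication by `X₂`, applied to `Y`. -/
noncomputable def doubleSeries (c : ℕ → ℕ → ℂ) (X₁ X₂ Y : H →L[ℂ] H) : H →L[ℂ] H :=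
  ∑' p : ℕ × ℕ, c p.1 p.2 • (X₁ ^ p.1 * Y * X₂ ^ p.2)

theorem norm_smul_mul_mul_le {T₁ T₂ : H →L[ℂ] H} {C₁ C₂ r₁ r₂ r : ℝ} (a : ℂ) (Y : H →L[ℂ] H)
    (i j : ℕ) (hC₁ : 0 ≤ C₁) (hC₂ : 0 ≤ C₂) (hr₁ : 0 ≤ r₁) (hr₂ : 0 ≤ r₂) (h₁r : r₁ ≤ r)
    (h₂r : r₂ ≤ r) (h₁ : ‖T₁‖ ≤ C₁ * r₁ ^ i) (h₂ : ‖T₂‖ ≤ C₂ * r₂ ^ j) :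
    ‖a • (T₁ * Y * T₂)‖ ≤ C₁ * ‖Y‖ * C₂ * (‖a‖ * (r ^ i * r ^ j)) := by
  have hr : 0 ≤ r := hr₁.trans h₁r
  rw [norm_smul]
  calc ‖a‖ * ‖T₁ * Y * T₂‖ ≤ ‖a‖ * ((C₁ * r ^ i) * ‖Y‖ * (C₂ * r ^ j)) := by
        refine mul_le_mul_of_nonneg_left ?_ (norm_nonneg a)
        refine (norm_mul_le _ _).trans ?_
        gcongr
        · refine (norm_mul_le _ _).trans ?_
          gcongr
          exact h₁.trans (by gcongr)
        · exact h₂.trans (by gcongr)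
    _ = _ := by ring

/-- Summing a double power series against factors that converge and obey a common geometric bound
below the radius of convergence commutes with the limit. -/
theorem tendsto_tsum_smul_mul_mul [CompleteSpace H] {α₁ α₂ : Type*} {l₁ : Filter α₁}
    {l₂ : Filter α₂} {c : ℕ → ℕ → ℂ} {R : ℝ} (hc : CauchyBounded c R) (X₁ X₂ Y : H →L[ℂ] H)
    {F₁ : α₁ → ℕ → (H →L[ℂ] H)} {F₂ : α₂ → ℕ → (H →L[ℂ] H)}
    (h₁ : ∀ i, Tendsto (fun a => F₁ a i) l₁ (𝓝 (X₁ ^ i)))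
    (h₂ : ∀ i, Tendsto (fun a => F₂ a i) l₂ (𝓝 (X₂ ^ i)))
    (hb₁ : ∃ r C : ℝ, 0 ≤ r ∧ r < R ∧ 0 ≤ C ∧ ∀ᶠ a in l₁, ∀ i : ℕ, ‖F₁ a i‖ ≤ C * r ^ i)
    (hb₂ : ∃ r C : ℝ, 0 ≤ r ∧ r < R ∧ 0 ≤ C ∧ ∀ᶠ a in l₂, ∀ i : ℕ, ‖F₂ a i‖ ≤ C * r ^ i) :
    Tendsto (fun a : α₁ × α₂ => ∑' p : ℕ × ℕ, c p.1 p.2 • (F₁ a.1 p.1 * Y * F₂ a.2 p.2))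
      (l₁ ×ˢ l₂) (𝓝 (doubleSeries c X₁ X₂ Y)) := by
  obtain ⟨r₁, C₁, hr₁, hr₁R, hC₁, hF₁⟩ := hb₁
  obtain ⟨r₂, C₂, hr₂, hr₂R, hC₂, hF₂⟩ := hb₂
  refine tendsto_tsum_of_dominated_convergence
    ((hc.summable (hr₁.trans (le_max_left r₁ r₂)) (max_lt hr₁R hr₂R)).mul_left (C₁ * ‖Y‖ * C₂))
    (fun p => ?_) ?_
  · exact ((((h₁ p.1).comp tendsto_fst).mul_const Y).mul ((h₂ p.2).comp tendsto_snd)).const_smul _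
  · filter_upwards [tendsto_fst.eventually hF₁, tendsto_snd.eventually hF₂] with a ha₁ ha₂ p
    exact norm_smul_mul_mul_le _ Y _ _ hC₁ hC₂ hr₁ hr₂ (le_max_left _ _) (le_max_right _ _)
      (ha₁ _) (ha₂ _)

theorem exists_eventually_norm_pow_le_of_spectrum_subset [CompleteSpace H] (X : H →L[ℂ] H) {R : ℝ}
    (hR : 0 < R) (hX : spectrum ℂ X ⊆ Metric.ball 0 R) :
    ∃ r C : ℝ, 0 ≤ r ∧ r < R ∧ 0 ≤ C ∧ ∀ᶠ X' in 𝓝 X, ∀ i : ℕ, ‖X' ^ i‖ ≤ C * r ^ i := by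
  obtain ⟨ρ, hρ0, hρR, hρ⟩ := SpectralDecomposition.exists_norm_le_of_spectrum_subset hR hX
  obtain ⟨r, hρr, hrR⟩ := exists_between hρR
  have hr : 0 < r := hρ0.trans_lt hρr
  have hrad : spectralRadius ℂ X < ENNReal.ofReal r := by
    refine lt_of_le_of_lt (b := ENNReal.ofReal ρ) (iSup₂_le fun z hz => ?_)
      ((ENNReal.ofReal_lt_ofReal_iff hr).2 hρr)
    rw [← enorm_eq_nnnorm, ← ofReal_norm]
    exact ENNReal.ofReal_le_ofReal (hρ z hz)
  obtain ⟨C, hC0, hC⟩ := exists_eventually_norm_pow_le X hr hrad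
  exact ⟨r, C, hr.le, hrR, hC0, hC⟩

variable [CompleteSpace H]

/-- Inserting the power series of `β` splits a Riemann sum of the double integral into products of
Riemann sums of single integrals. -/
theorem hasSum_riemannSum {X₁ X₂ : H →L[ℂ] H} (D₁ : SpectralDecomposition X₁)
    (D₂ : SpectralDecomposition X₂) {c : ℕ → ℕ → ℂ} {β : ℂ → ℂ → ℂ} {R : ℝ}
    (hc : CauchyBounded c R)
    (hβ : ∀ x ∈ Metric.ball (0 : ℂ) R, ∀ y ∈ Metric.ball (0 : ℂ) R,
      HasSum (fun p : ℕ × ℕ => c p.1 p.2 * (x ^ p.1 * y ^ p.2)) (β x y))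
    (h₁ : spectrum ℂ X₁ ⊆ Metric.ball 0 R) (h₂ : spectrum ℂ X₂ ⊆ Metric.ball 0 R)
    (Y : H →L[ℂ] H) (P : TaggedPartition (spectrum ℂ X₁)) (Q : TaggedPartition (spectrum ℂ X₂)) :
    HasSum (fun p : ℕ × ℕ => c p.1 p.2 • (D₁.powSum P p.1 * Y * D₂.powSum Q p.2))
      (riemannSum D₁ D₂ β Y P Q) := by
  have hterm : ∀ p : ℕ × ℕ, c p.1 p.2 • (D₁.powSum P p.1 * Y * D₂.powSum Q p.2) =
      ∑ A ∈ P.cells.parts, ∑ B ∈ Q.cells.parts,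
        ∑ q₁ ∈ Finset.range (D₁.m (P.tag A)), ∑ q₂ ∈ Finset.range (D₂.m (Q.tag B)),
          (c p.1 p.2 * ((p.1.choose q₁ : ℂ) * P.tag A ^ (p.1 - q₁) *
            ((p.2.choose q₂ : ℂ) * Q.tag B ^ (p.2 - q₂)))) •
          ((X₁ - P.tag A • (1 : H →L[ℂ] H)) ^ q₁ * D₁.E A * Y *
            ((X₂ - Q.tag B • (1 : H →L[ℂ] H)) ^ q₂ * D₂.E B)) := by
    intro p
    simp only [SpectralDecomposition.powSum, Finset.sum_mul, Finset.smul_sum]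
    refine Finset.sum_congr rfl fun A _ => ?_
    simp only [Finset.mul_sum, Finset.smul_sum]
    rw [Finset.sum_comm]
    refine Finset.sum_congr rfl fun B _ => ?_
    refine Finset.sum_congr rfl fun q₁ _ => ?_
    refine Finset.sum_congr rfl fun q₂ _ => ?_
    rw [smul_mul_assoc, smul_mul_assoc, mul_smul_comm, smul_smul, smul_smul,
      mul_assoc (c p.1 p.2)]
  simp only [hterm]
  refine hasSum_sum fun A hA => hasSum_sum fun B hB => hasSum_sum fun q₁ _ =>
    hasSum_sum fun q₂ _ => ?_
  exact (hasSum_partialDeriv₂ hc hβ (h₁ (P.tag_mem_set hA)) (h₂ (Q.tag_mem_set hB))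
    q₁ q₂).smul_const _

/-- The generalized double operator integral of a double power series exists and is the value of
that series at the operators. -/
theorem hasGDOI_doubleSeries {X₁ X₂ : H →L[ℂ] H} (D₁ : SpectralDecomposition X₁)
    (D₂ : SpectralDecomposition X₂) {c : ℕ → ℕ → ℂ} {β : ℂ → ℂ → ℂ} {R : ℝ} (hR : 0 < R)
    (hc : CauchyBounded c R)
    (hβ : ∀ x ∈ Metric.ball (0 : ℂ) R, ∀ y ∈ Metric.ball (0 : ℂ) R,
      HasSum (fun p : ℕ × ℕ => c p.1 p.2 * (x ^ p.1 * y ^ p.2)) (β x y))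
    (h₁ : spectrum ℂ X₁ ⊆ Metric.ball 0 R) (h₂ : spectrum ℂ X₂ ⊆ Metric.ball 0 R)
    (Y : H →L[ℂ] H) : HasGDOI D₁ D₂ β Y (doubleSeries c X₁ X₂ Y) := by
  have h := tendsto_tsum_smul_mul_mul hc X₁ X₂ Y D₁.tendsto_powSum D₂.tendsto_powSum
    (D₁.exists_eventually_norm_powSum_le hR h₁) (D₂.exists_eventually_norm_powSum_le hR h₂)
  refine h.congr fun p => ?_
  exact (hasSum_riemannSum D₁ D₂ hc hβ h₁ h₂ Y p.1 p.2).tsum_eq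

/-- The value of a double power series depends jointly continuously, in operator norm, on the
operators. -/
theorem tendsto_doubleSeries {α₁ α₂ : Type*} {l₁ : Filter α₁} {l₂ : Filter α₂}
    {c : ℕ → ℕ → ℂ} {R : ℝ} (hc : CauchyBounded c R) (hR : 0 < R) {X₁ X₂ : H →L[ℂ] H}
    (h₁ : spectrum ℂ X₁ ⊆ Metric.ball 0 R) (h₂ : spectrum ℂ X₂ ⊆ Metric.ball 0 R)
    (Y : H →L[ℂ] H) {F₁ : α₁ → (H →L[ℂ] H)} {F₂ : α₂ → (H →L[ℂ] H)}
    (hF₁ : Tendsto F₁ l₁ (𝓝 X₁)) (hF₂ : Tendsto F₂ l₂ (𝓝 X₂)) :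
    Tendsto (fun a : α₁ × α₂ => doubleSeries c (F₁ a.1) (F₂ a.2) Y) (l₁ ×ˢ l₂)
      (𝓝 (doubleSeries c X₁ X₂ Y)) := by
  obtain ⟨r₁, C₁, hr₁, hr₁R, hC₁, hb₁⟩ := exists_eventually_norm_pow_le_of_spectrum_subset X₁ hR h₁
  obtain ⟨r₂, C₂, hr₂, hr₂R, hC₂, hb₂⟩ := exists_eventually_norm_pow_le_of_spectrum_subset X₂ hR h₂
  exact tendsto_tsum_smul_mul_mul hc X₁ X₂ Y (F₁ := fun a i => F₁ a ^ i) (F₂ := fun a i => F₂ a ^ i)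
    (fun i => hF₁.pow i) (fun i => hF₂.pow i)
    ⟨r₁, C₁, hr₁, hr₁R, hC₁, hF₁.eventually hb₁⟩ ⟨r₂, C₂, hr₂, hr₂R, hC₂, hF₂.eventually hb₂⟩

end DoubleSeries

end GDOI

theorem mainTheorem8 {H : Type*} [NormedAddCommGroup H] [InnerProductSpace ℂ H] [CompleteSpace H]
    (X₁seq X₂seq : ℕ → (H →L[ℂ] H)) (X₁ X₂ Y : H →L[ℂ] H)
    (D₁seq : ∀ n, GDOI.SpectralDecomposition (X₁seq n))
    (D₂seq : ∀ n, GDOI.SpectralDecomposition (X₂seq n))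
    (D₁ : GDOI.SpectralDecomposition X₁) (D₂ : GDOI.SpectralDecomposition X₂)
    (hX₁ : Tendsto X₁seq atTop (𝓝 X₁)) (hX₂ : Tendsto X₂seq atTop (𝓝 X₂))
    (f : ℂ → ℂ) (R : ℝ) (hf : AnalyticOnNhd ℂ f (Metric.ball 0 R))
    (K : Set ℂ)
    (hK : K = (⋃ n, spectrum ℂ (X₁seq n)) ∪ spectrum ℂ X₁ ∪
      (⋃ n, spectrum ℂ (X₂seq n)) ∪ spectrum ℂ X₂)
    (hKR : K ⊆ Metric.ball 0 R)
    (hf₂ : ∀ q₁ q₂ q₃ : ℕ, ∃ C : ℝ, ∀ z₁ ∈ K, ∀ z₂ ∈ K, ∀ z₃ ∈ K,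
      ‖GDOI.partialDeriv₃ (GDOI.dividedDiff₂ f) q₁ q₂ q₃ z₁ z₂ z₃‖ ≤ C) :
    (∀ n₁ n₂, GDOI.HasGDOI (D₁seq n₁) (D₂seq n₂) (GDOI.dividedDiff₁ f) Y
      (GDOI.gdoi (D₁seq n₁) (D₂seq n₂) (GDOI.dividedDiff₁ f) Y)) ∧
    GDOI.HasGDOI D₁ D₂ (GDOI.dividedDiff₁ f) Y (GDOI.gdoi D₁ D₂ (GDOI.dividedDiff₁ f) Y) ∧
    Tendsto (fun p : ℕ × ℕ =>
        ‖GDOI.gdoi (D₁seq p.1) (D₂seq p.2) (GDOI.dividedDiff₁ f) Y -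
          GDOI.gdoi D₁ D₂ (GDOI.dividedDiff₁ f) Y‖)
      (atTop ×ˢ atTop) (𝓝 0) := by
  subst hK
  simp only [Set.union_subset_iff, Set.iUnion_subset_iff] at hKR
  obtain ⟨⟨⟨hs₁, h₁⟩, hs₂⟩, h₂⟩ := hKR
  rcases le_or_gt R 0 with hR | hR
  · -- the spectrum of `X₁` is empty, so that `1 = E(∅) = 0` and there is only one operator
    have hempty : spectrum ℂ X₁ = ∅ := by
      rw [← Set.subset_empty_iff, ← Metric.ball_eq_empty.2 hR]
      exact h₁
    have h01 : (0 : H →L[ℂ] H) = 1 := by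
      rw [← D₁.E_spectrum, hempty, D₁.E_empty]
    have hsub : Subsingleton (H →L[ℂ] H) := subsingleton_of_zero_eq_one h01
    have hG : ∀ {Z₁ Z₂ : H →L[ℂ] H} (G₁ : GDOI.SpectralDecomposition Z₁)
        (G₂ : GDOI.SpectralDecomposition Z₂) (β : ℂ → ℂ → ℂ) (T : H →L[ℂ] H),
        GDOI.HasGDOI G₁ G₂ β Y T := fun G₁ G₂ β T =>
      tendsto_const_nhds.congr fun _ => Subsingleton.elim T _
    refine ⟨fun _ _ => hG _ _ _ _, hG _ _ _ _, tendsto_const_nhds.congr fun p => ?_⟩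
    rw [Subsingleton.elim (GDOI.gdoi (D₁seq p.1) (D₂seq p.2) (GDOI.dividedDiff₁ f) Y -
      GDOI.gdoi D₁ D₂ (GDOI.dividedDiff₁ f) Y) 0, norm_zero]
  obtain ⟨c, hc, hβ⟩ := GDOI.exists_hasSum_dividedDiff₁ hf
  have hseq := fun n₁ n₂ => GDOI.hasGDOI_doubleSeries (D₁seq n₁) (D₂seq n₂) hR hc hβ
    (hs₁ n₁) (hs₂ n₂) Y
  have hlim := GDOI.hasGDOI_doubleSeries D₁ D₂ hR hc hβ h₁ h₂ Y
  refine ⟨fun n₁ n₂ => by rw [(hseq n₁ n₂).gdoi_eq]; exact hseq n₁ n₂,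
    by rw [hlim.gdoi_eq]; exact hlim, ?_⟩
  have hconv := GDOI.tendsto_doubleSeries hc hR h₁ h₂ Y hX₁ hX₂
  simp only [fun n₁ n₂ => (hseq n₁ n₂).gdoi_eq, hlim.gdoi_eq]
  exact tendsto_iff_norm_sub_tendsto_zero.1 hconv
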